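/- Let $M>0$, let $X=[0,M]$ with periodic boundary conditions, and let $H^n=H^n(X)$ denote the Sobolev space of real $M$-periodic functions (for $n\ge1$ identified with their continuous representatives), with norm $\|v\|_{n}^2=M\sum_{k\in\mathbb Z}(1+(2\pi k/M)^2)^n|\hat v(k)|^2\in[0,\infty]$. Consider one of the equations * $K(2,2)$: $u_t=2uu_{xxx}+6u_xu_{xx}+2uu_x$; * Harry Dym: $u_t=u^3u_{xxx}$; * Goodman–Lax: $u_t+uu_x+\tfrac16\Delta^2uu_{xxx}=0$, with a constant $\Delta\in\mathbb R$; * Zumbrun: $u_t+(u^2)_x=-c_2a^2(uu_{xx})_x$, with constants $c_2,a\in\mathbb R$. An *$H^4$ solution on $[0,T]$* is a $u\in C([0,T];H^4)$ that satisfies the equation at every point of $[0,T]\times X$. A *(possibly singular) solution on $[0,S]$ with initial data $u_0$* is a curve $u$ in $C([0,S];L^2(X))$, with $u(\cdot,t)$ continuous and $M$-periodic for every $t$ and $u(\cdot,0)=u_0$, such that for every $T\in[0,S]$ with $u(\cdot,t)\in H^4$ for all $t\in[0,T]$: (i) $u$ is an $H^4$ solution on $[0,T]$; and (ii) if $T<S$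 and $u(\cdot,T)>0$ on $X$, then there is $T'\in(T,S]$ with $u(\cdot,t)\in H^4$ for all $t\in[0,T']$ (the solution does not stop at a positive $H^4$ state). Nothing more is required of $u$ once it has left $H^4$ or has lost its positivity. Let $n\ge4$ be an integer, $a_0>0$, and $u_0\in H^n(X)$ with $u_0(x)>a_0$ for all $x\in X$. Let $t_*>0$ and let $u$ be a solution, in this sense, on $[0,t_*]$ of one of the four equations with $u(x,0)=u_0(x)$. Assume that there is a point $x_*$ with $u(x_*,t_*)=0$. Then there exists $t_{**}\in(0,t_*]$ such that $u(\cdot,t)\in H^4$ for all $t\in[0,t_{**})$ and $$\lim_{t\to t_{**}^-}\|u(\cdot,t)\|_{4}=+\infty .$$ -/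

import Mathlib

open Set Filter Topology
open scoped ENNReal

noncomputable section

/-- The four quasilinear evolution equations; `goodmanLax Δ` carries the constant spatial step `Δ`,
and `zumbrun c₂ a` the two constants `c₂` and `a`. -/
inductive QEquation : Type where
  | k22 : QEquation
  | harryDym : QEquation
  | goodmanLax (Δ : ℝ) : QEquation
  | zumbrun (c₂ a : ℝ) : QEquation

/-- The right-hand side `R` of the equation, written in the form `u_t = R[u]`:
* `K(2,2)`: `u_t = 2 u u_xxx + 6 u_x u_xx + 2 u u_x`;
* Harry Dym: `u_t = u ^ 3 u_xxx`;
* Goodman and Lax: `u_t + u u_x + (1/6) Δ ^ 2 u u_xxx = 0`;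
* Zumbrun: `u_t + (u ^ 2)_x = - c₂ a ^ 2 (u u_xx)_x`. -/
def QEquation.rhs : QEquation → (ℝ → ℝ) → ℝ → ℝ
  | .k22, v, x =>
      2 * v x * iteratedDeriv 3 v x + 6 * deriv v x * iteratedDeriv 2 v x + 2 * v x * deriv v x
  | .harryDym, v, x => v x ^ 3 * iteratedDeriv 3 v x
  | .goodmanLax Δ, v, x => -(v x * deriv v x) - 1 / 6 * Δ ^ 2 * v x * iteratedDeriv 3 v x
  | .zumbrun c₂ a, v, x =>
      -deriv (fun y => v y ^ 2) x - c₂ * a ^ 2 * deriv (fun y => v y * iteratedDeriv 2 v y) x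

/-- The norm of the Sobolev space `H^n` of `M`-periodic functions, with values in `[0, ∞]`:
`‖v‖² = M ∑ₖ (1 + (2πk/M)²)ⁿ |v̂(k)|²`. For `n = 0` this is the norm of `L²(0, M)`. -/
def sobolevENorm {M : ℝ} (hM : 0 < M) (n : ℕ) (v : ℝ → ℝ) : ℝ≥0∞ :=
  (∑' k : ℤ, ENNReal.ofReal (M * (1 + (2 * Real.pi * (k : ℝ) / M) ^ 2) ^ n *
    ‖fourierCoeffOn hM (fun x => (v x : ℂ)) k‖ ^ 2)) ^ (1 / 2 : ℝ)

/-- `v` is (the continuous representative of) an element of `H^n`, `n ≥ 1`, of the periodic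
interval of length `M`. -/
structure MemSobolev {M : ℝ} (hM : 0 < M) (n : ℕ) (v : ℝ → ℝ) : Prop where
  continuous : Continuous v
  periodic : Function.Periodic v M
  finite : sobolevENorm hM n v < ∞

/-- The curve `t ↦ u t` is continuous on `[0, T]` in the norm of `H^n`. -/
def SobolevContinuousOn {M : ℝ} (hM : 0 < M) (n : ℕ) (u : ℝ → ℝ → ℝ) (T : ℝ) : Prop :=
  ∀ t ∈ Icc 0 T,
    Tendsto (fun s => sobolevENorm hM n (fun x => u s x - u t x)) (𝓝[Icc 0 T] t) (𝓝 0)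

/-- `u ∈ C([0, T]; H⁴)`, and `u` solves the equation on `[0, T]`. (Functions in `H⁴` are of class
`C³`, so that the equation makes sense at every point.) -/
structure IsH4Solution {M : ℝ} (hM : 0 < M) (E : QEquation) (u : ℝ → ℝ → ℝ) (T : ℝ) : Prop where
  mem : ∀ t ∈ Icc 0 T, MemSobolev hM 4 (u t)
  continuous : SobolevContinuousOn hM 4 u T
  solves : ∀ t ∈ Icc 0 T, ∀ x : ℝ,
    HasDerivWithinAt (fun s => u s x) (E.rhs (u t) x) (Icc 0 T) t

/-- `u` is a solution of the initial value problem with data `u₀` on `[0, S]` that may become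
singular: a curve of continuous periodic functions, continuous in `L²`, which is a solution in
`C([0, T]; H⁴)` as long as it takes values in `H⁴`, and which, being the solution of the initial
value problem, does not stop at a time at which it is a positive function in `H⁴`. Nothing more is
asked of `u` after it has left `H⁴` or has lost its positivity. -/
structure IsSingularSolution {M : ℝ} (hM : 0 < M) (E : QEquation) (u₀ : ℝ → ℝ)
    (u : ℝ → ℝ → ℝ) (S : ℝ) : Prop where
  initial : u 0 = u₀
  continuous : ∀ t ∈ Icc 0 S, Continuous (u t)
  periodic : ∀ t ∈ Icc 0 S, Function.Periodic (u t) M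
  continuous_L2 : SobolevContinuousOn hM 0 u S
  solution : ∀ T ∈ Icc 0 S, (∀ t ∈ Icc 0 T, MemSobolev hM 4 (u t)) → IsH4Solution hM E u T
  continued : ∀ T ∈ Ico 0 S, (∀ t ∈ Icc 0 T, MemSobolev hM 4 (u t)) → (∀ x, 0 < u T x) →
    ∃ T' ∈ Ioc T S, ∀ t ∈ Icc 0 T', MemSobolev hM 4 (u t)

end

/-! At a spatial minimum u_x = 0, and there each of the four right-hand sides reduces to c(u) u
u_xxx. Because of the factor u, while |u_xxx| ≤ K the minimum can decay no faster than
exponentially, so it cannot reach 0. Since H⁴ embeds in C³, such a K exists on every compact time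
interval on which the solution stays in C([0,T]; H⁴). A zero at time t_* therefore means that the
solution has left H⁴.

Let τ be the supremum of the times up to which u remains in H⁴. Then u(τ) is not in H⁴: otherwise it
would be positive, which contradicts the zero if τ = t_* and the maximality of τ, by continuation,
if τ < t_*. The norm has limit +∞, not merely limsup +∞: if it were bounded along some times tending
to τ from the left, L² continuity and lower semicontinuity of the H⁴ norm would put u(τ) in H⁴. -/

/-- The square of the Sobolev norm of a function of finite norm is the sum of a real series. -/
theorem hasSum_sobolevENorm_sq {M : ℝ} (hM : 0 < M) (n : ℕ) {v : ℝ → ℝ}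
    (hv : sobolevENorm hM n v < ∞) :
    HasSum (fun k : ℤ => M * (1 + (2 * Real.pi * (k : ℝ) / M) ^ 2) ^ n *
      ‖fourierCoeffOn hM (fun x => (v x : ℂ)) k‖ ^ 2) ((sobolevENorm hM n v).toReal ^ 2) := by
  set w : ℤ → ℝ := fun k : ℤ => M * (1 + (2 * Real.pi * (k : ℝ) / M) ^ 2) ^ n *
      ‖fourierCoeffOn hM (fun x => (v x : ℂ)) k‖ ^ 2 with hw
  have hw0 : ∀ k, 0 ≤ w k := fun k => by positivity
  have hfin : ∑' k, ENNReal.ofReal (w k) ≠ ∞ := by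
    intro h
    rw [sobolevENorm, h, ENNReal.top_rpow_of_pos (by norm_num)] at hv
    exact lt_irrefl _ hv
  have hsum : Summable w := by
    simpa [ENNReal.toReal_ofReal (hw0 _)] using ENNReal.summable_toReal hfin
  have : (sobolevENorm hM n v).toReal ^ 2 = ∑' k, w k := by
    change ((∑' k, ENNReal.ofReal (w k)) ^ (1 / 2 : ℝ)).toReal ^ 2 = _
    rw [← ENNReal.ofReal_tsum_of_nonneg hw0 hsum, ← ENNReal.toReal_rpow,
      ENNReal.toReal_ofReal (tsum_nonneg hw0), ← Real.sqrt_eq_rpow,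
      Real.sq_sqrt (tsum_nonneg hw0)]
  rw [this]
  exact hsum.hasSum

theorem sobolevENorm_le_of_sum_le {M : ℝ} (hM : 0 < M) (n : ℕ) {v : ℝ → ℝ} {K : ℝ}
    (h : ∀ F : Finset ℤ, ∑ k ∈ F, M * (1 + (2 * Real.pi * (k : ℝ) / M) ^ 2) ^ n *
      ‖fourierCoeffOn hM (fun x => (v x : ℂ)) k‖ ^ 2 ≤ K) :
    sobolevENorm hM n v < ∞ := by
  refine ENNReal.rpow_lt_top_of_nonneg (by norm_num) (ne_top_of_le_ne_top
    (ENNReal.ofReal_ne_top (r := K)) (ENNReal.summable.tsum_le_of_sum_le fun F => ?_))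
  rw [← ENNReal.ofReal_sum_of_nonneg fun k _ => by positivity]
  exact ENNReal.ofReal_le_ofReal (h F)

theorem sobolevENorm_mono {M : ℝ} (hM : 0 < M) {m n : ℕ} (hmn : m ≤ n) (v : ℝ → ℝ) :
    sobolevENorm hM m v ≤ sobolevENorm hM n v := by
  refine ENNReal.rpow_le_rpow (ENNReal.tsum_le_tsum fun k => ENNReal.ofReal_le_ofReal ?_)
    (by norm_num)
  gcongr
  nlinarith [sq_nonneg (2 * Real.pi * (k : ℝ) / M)]

theorem MemSobolev.mono {M : ℝ} {hM : 0 < M} {m n : ℕ} (hmn : m ≤ n) {v : ℝ → ℝ}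
    (hv : MemSobolev hM n v) : MemSobolev hM m v :=
  ⟨hv.continuous, hv.periodic, (sobolevENorm_mono hM hmn v).trans_lt hv.finite⟩

theorem fourierCoeffOn_sub_ofReal {M : ℝ} (hM : 0 < M) {v w : ℝ → ℝ} (hv : Continuous v)
    (hw : Continuous w) (k : ℤ) :
    fourierCoeffOn hM (fun x => ((v x - w x : ℝ) : ℂ)) k =
      fourierCoeffOn hM (fun x => (v x : ℂ)) k - fourierCoeffOn hM (fun x => (w x : ℂ)) k := by
  simp only [fourierCoeffOn_eq_integral, ← smul_sub]
  have hc : Continuous fun x : ℝ => (fourier (-k) (x : AddCircle (M - 0)) : ℂ) :=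
    (map_continuous (fourier (-k))).comp (AddCircle.continuous_mk' _)
  rw [← intervalIntegral.integral_sub]
  · simp only [smul_eq_mul, Complex.ofReal_sub, mul_sub]
  all_goals exact Continuous.intervalIntegrable (by fun_prop) _ _

/-- A single Fourier coefficient is bounded by the Sobolev norm. -/
theorem norm_fourierCoeffOn_sq_le {M : ℝ} (hM : 0 < M) (n : ℕ) {v : ℝ → ℝ}
    (hv : sobolevENorm hM n v < ∞) (k : ℤ) :
    M * ‖fourierCoeffOn hM (fun x => (v x : ℂ)) k‖ ^ 2 ≤ (sobolevENorm hM n v).toReal ^ 2 := by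
  refine le_trans ?_ (le_hasSum (hasSum_sobolevENorm_sq hM n hv) k fun j _ => by positivity)
  have : 1 ≤ (1 + (2 * Real.pi * (k : ℝ) / M) ^ 2) ^ n :=
    one_le_pow₀ (by nlinarith [sq_nonneg (2 * Real.pi * (k : ℝ) / M)])
  gcongr
  nlinarith

/-- Sobolev norms are lower semicontinuous with respect to convergence in a Sobolev space of lower
order. -/
theorem memSobolev_of_tendsto_of_frequently {M : ℝ} (hM : 0 < M) (m n : ℕ) {u : ℝ → ℝ → ℝ}
    {l : Filter ℝ} {v : ℝ → ℝ} (hvc : Continuous v) (hvp : Function.Periodic v M)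
    (huc : ∀ᶠ s in l, Continuous (u s))
    (hlim : Tendsto (fun s => sobolevENorm hM m (fun x => u s x - v x)) l (𝓝 0)) {K : ℝ}
    (hK : ∃ᶠ s in l, sobolevENorm hM n (u s) ≤ ENNReal.ofReal K) : MemSobolev hM n v := by
  have hcoef : ∀ k, Tendsto (fun s => fourierCoeffOn hM (fun x => (u s x : ℂ)) k) l
      (𝓝 (fourierCoeffOn hM (fun x => (v x : ℂ)) k)) := by
    intro k
    rw [tendsto_iff_norm_sub_tendsto_zero]
    have hlim' : Tendsto (fun s => Real.sqrt
        ((sobolevENorm hM m (fun x => u s x - v x)).toReal ^ 2 / M)) l (𝓝 0) := by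
      have := (ENNReal.tendsto_toReal ENNReal.zero_ne_top).comp hlim
      simpa using (((this.pow 2).div_const M).sqrt)
    refine squeeze_zero' (Eventually.of_forall fun s => norm_nonneg _) ?_ hlim'
    filter_upwards [huc, hlim.eventually_lt_const ENNReal.zero_lt_top] with s hs hfin
    rw [← fourierCoeffOn_sub_ofReal hM hs hvc]
    refine Real.le_sqrt_of_sq_le ?_
    rw [le_div_iff₀ hM, mul_comm]
    exact norm_fourierCoeffOn_sq_le hM m hfin k
  refine ⟨hvc, hvp, sobolevENorm_le_of_sum_le hM n (K := (ENNReal.ofReal K).toReal ^ 2)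
    fun F => ?_⟩
  -- Fatou's argument: a finite partial sum depends on finitely many coefficients, all of which
  -- converge, so a bound that holds only frequently passes to the limit.
  refine le_of_tendsto_of_frequently
    (tendsto_finsetSum F fun k _ => ((hcoef k).norm.pow 2).const_mul _) (hK.mono fun s hs => ?_)
  have hfin : sobolevENorm hM n (u s) < ∞ := hs.trans_lt ENNReal.ofReal_lt_top
  refine (sum_le_hasSum F (fun k _ => by positivity) (hasSum_sobolevENorm_sq hM n hfin)).trans ?_
  gcongr
  exact ENNReal.ofReal_ne_top

/-! ### Fourier series and the Sobolev embedding -/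

theorem iteratedDeriv_const_mul_cexp (c a : ℂ) (j : ℕ) :
    iteratedDeriv j (fun x : ℝ => c * Complex.exp (a * x)) =
      fun x : ℝ => a ^ j * (c * Complex.exp (a * x)) := by
  induction j with
  | zero => simp
  | succ j ih =>
    rw [iteratedDeriv_succ, ih]
    funext x
    have h : HasDerivAt (fun x : ℝ => a * (x : ℂ)) (a * 1) x :=
      (Complex.ofRealCLM.hasDerivAt (x := x)).const_mul a
    rw [((h.cexp.const_mul c).const_mul (a ^ j)).deriv]
    ring

/-- A continuous periodic function with absolutely summable Fourier coefficients is the sum of its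
Fourier series. -/
theorem hasSum_fourierCoeffOn {M : ℝ} (hM : 0 < M) {v : ℝ → ℝ} (hvc : Continuous v)
    (hvp : Function.Periodic v M)
    (hs : Summable fun k => ‖fourierCoeffOn hM (fun x => (v x : ℂ)) k‖) (x : ℝ) :
    HasSum (fun k : ℤ => fourierCoeffOn hM (fun x => (v x : ℂ)) k *
      Complex.exp (((2 * Real.pi * k / M : ℝ) * Complex.I) * x)) (v x : ℂ) := by
  have : Fact (0 < M) := ⟨hM⟩
  have hV : Function.Periodic (fun x => (v x : ℂ)) M := fun x => by simp only [hvp x]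
  let f : C(AddCircle M, ℂ) := ⟨hV.lift, continuous_coinduced_dom.mpr
    (Complex.continuous_ofReal.comp hvc)⟩
  have hf : ∀ x : ℝ, f x = (v x : ℂ) := fun x => hV.lift_coe x
  have hcoef : ∀ k, fourierCoeff f k = fourierCoeffOn hM (fun x => (v x : ℂ)) k := by
    intro k
    rw [fourierCoeffOn_eq_integral, fourierCoeff_eq_intervalIntegral _ _ 0]
    simp only [fourier_coe_apply, hf, zero_add, sub_zero]
  have := has_pointwise_sum_fourier_series_of_summable (f := f)
    (by simp only [funext hcoef]; exact hs.of_norm) (x : AddCircle M)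
  simp only [hcoef, hf, fourier_coe_apply, smul_eq_mul] at this
  convert this using 4
  push_cast
  ring

theorem summable_inv_one_add_sq {M : ℝ} (hM : 0 < M) :
    Summable fun k : ℤ => (1 + (2 * Real.pi * (k : ℝ) / M) ^ 2)⁻¹ := by
  have h2 : Summable fun k : ℤ => (M / (2 * Real.pi)) ^ 2 * (1 / (k : ℝ) ^ 2) :=
    (Real.summable_one_div_int_pow.mpr one_lt_two).mul_left _
  refine h2.of_norm_bounded_eventually ?_
  rw [Int.cofinite_eq, eventually_sup]
  have key : ∀ k : ℤ, k ≠ 0 → ‖(1 + (2 * Real.pi * (k : ℝ) / M) ^ 2)⁻¹‖ ≤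
      (M / (2 * Real.pi)) ^ 2 * (1 / (k : ℝ) ^ 2) := by
    intro k hk
    have hk' : (k : ℝ) ≠ 0 := by exact_mod_cast hk
    rw [Real.norm_of_nonneg (by positivity)]
    have : (M / (2 * Real.pi)) ^ 2 * (1 / (k : ℝ) ^ 2) = ((2 * Real.pi * (k : ℝ) / M) ^ 2)⁻¹ := by
      field_simp
    rw [this]
    have hp : 0 < (2 * Real.pi * (k : ℝ) / M) ^ 2 := by positivity
    gcongr
    linarith
  exact ⟨(eventually_lt_atBot 0).mono fun k hk => key k hk.ne,
    (eventually_gt_atTop 0).mono fun k hk => key k hk.ne'⟩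

/-- The Sobolev embedding of `H⁴` into `C³` on the circle. -/
theorem exists_sobolev_embedding {M : ℝ} (hM : 0 < M) :
    ∃ C : ℝ, 0 ≤ C ∧ ∀ v, MemSobolev hM 4 v → ContDiff ℝ 3 v ∧ ∀ j ≤ 3, ∀ x,
      |iteratedDeriv j v x| ≤ C * (sobolevENorm hM 4 v).toReal := by
  set κ : ℤ → ℝ := fun k => 2 * Real.pi * (k : ℝ) / M with hκ
  have hS := summable_inv_one_add_sq hM
  refine ⟨√(∑' k, (1 + κ k ^ 2)⁻¹) * (√M)⁻¹, by positivity, fun v hv => ?_⟩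
  set c : ℤ → ℂ := fun k => fourierCoeffOn hM (fun x => (v x : ℂ)) k with hc
  set N := (sobolevENorm hM 4 v).toReal with hN
  have hN0 : 0 ≤ N := ENNReal.toReal_nonneg
  have hsq : HasSum (fun k => ((1 + κ k ^ 2) ^ 2 * ‖c k‖) ^ (2 : ℝ)) (N ^ 2 / M) := by
    have := (hasSum_sobolevENorm_sq hM 4 hv.finite).div_const M
    refine (congrArg (HasSum · _) (funext fun k => ?_)).mp this
    rw [Real.rpow_two]
    simp only [hκ, hc]
    field_simp
  have hsq' : HasSum (fun k => (√(1 + κ k ^ 2)⁻¹) ^ (2 : ℝ)) (∑' k, (1 + κ k ^ 2)⁻¹) := by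
    refine (congrArg (HasSum · _) (funext fun k => ?_)).mp hS.hasSum
    rw [Real.rpow_two, Real.sq_sqrt (by positivity)]
  -- Cauchy–Schwarz for (1 + κ²)^(3/2) |c| = (1 + κ²)^(-1/2) · (1 + κ²)² |c|. The left side
  -- dominates the modes of all derivatives of order at most three.
  obtain ⟨hsum, hle⟩ := Real.summable_and_inner_le_Lp_mul_Lq_tsum_of_nonneg
    Real.HolderConjugate.two_two (fun k => by positivity) (fun k => by positivity)
    hsq'.summable hsq.summable
  rw [hsq'.tsum_eq, hsq.tsum_eq, ← Real.sqrt_eq_rpow, ← Real.sqrt_eq_rpow,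
    Real.sqrt_div (sq_nonneg N), Real.sqrt_sq hN0] at hle
  set b : ℤ → ℝ := fun k => √(1 + κ k ^ 2)⁻¹ * ((1 + κ k ^ 2) ^ 2 * ‖c k‖) with hb
  have hbound : ∀ j ≤ 3, ∀ k, |κ k| ^ j * ‖c k‖ ≤ b k := by
    intro j hj k
    rw [hb]
    simp only
    rw [← mul_assoc]
    refine mul_le_mul_of_nonneg_right (abs_le_of_sq_le_sq' ?_ (by positivity)).2 (norm_nonneg _)
    rw [mul_pow, Real.sq_sqrt (by positivity), ← pow_mul, mul_comm j 2, pow_mul, sq_abs]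
    have h1 : (κ k ^ 2) ^ j ≤ (1 + κ k ^ 2) ^ 3 := by
      calc (κ k ^ 2) ^ j ≤ (1 + κ k ^ 2) ^ j := by gcongr; linarith
        _ ≤ (1 + κ k ^ 2) ^ 3 := pow_le_pow_right₀ (by nlinarith [sq_nonneg (κ k)]) hj
    refine h1.trans_eq ?_
    field_simp
  set g : ℤ → ℝ → ℂ := fun k x => c k * Complex.exp ((κ k * Complex.I) * x) with hg
  have hgd : ∀ k, ContDiff ℝ 3 (g k) := fun k =>
    contDiff_const.mul ((contDiff_const.mul Complex.ofRealCLM.contDiff).cexp)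
  have hnorm : ∀ (j : ℕ) (k : ℤ) (x : ℝ), (j : ℕ∞) ≤ (3 : ℕ) →
      ‖iteratedFDeriv ℝ j (g k) x‖ ≤ b k := by
    intro j k x hj
    rw [norm_iteratedFDeriv_eq_norm_iteratedDeriv, hg]
    simp only
    rw [iteratedDeriv_const_mul_cexp]
    refine le_trans (le_of_eq ?_) (hbound j (by exact_mod_cast hj) k)
    have : ‖Complex.exp ((κ k * Complex.I) * x)‖ = 1 := by
      rw [mul_right_comm, ← Complex.ofReal_mul, Complex.norm_exp_ofReal_mul_I]
    rw [norm_mul, norm_mul, this, norm_pow, norm_mul, Complex.norm_I, Complex.norm_real,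
      Real.norm_eq_abs]
    ring
  have hser : (fun x => (v x : ℂ)) = fun x => ∑' k, g k x := by
    funext x
    refine ((hasSum_fourierCoeffOn hM hv.continuous hv.periodic ?_ x).tsum_eq).symm
    exact hsum.of_nonneg_of_le (fun k => norm_nonneg _) fun k => by
      simpa using hbound 0 (by norm_num) k
  have hV : ContDiff ℝ 3 fun x => (v x : ℂ) := by
    rw [hser]
    exact contDiff_tsum (N := (3 : ℕ)) hgd (fun _ _ => hsum) 
      fun j k x hj => hnorm j k x (by exact_mod_cast hj)
  have hv3 : ContDiff ℝ 3 v := Complex.reCLM.contDiff.comp hV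
  refine ⟨hv3, fun j hj x => ?_⟩
  have hre : v = Complex.reCLM ∘ fun x => (v x : ℂ) := by
    funext x; simp
  rw [← Real.norm_eq_abs, ← norm_iteratedFDeriv_eq_norm_iteratedDeriv, hre]
  refine (Complex.reCLM.norm_iteratedFDeriv_comp_left hV.contDiffAt (by exact_mod_cast hj)).trans ?_
  rw [Complex.reCLM_norm, one_mul, hser, iteratedFDeriv_tsum_apply (N := (3 : ℕ)) hgd
    (fun _ _ => hsum) hnorm (by exact_mod_cast hj)]
  refine (tsum_of_norm_bounded hsum.hasSum fun k => hnorm j k x (by exact_mod_cast hj)).trans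
    (hle.trans_eq ?_)
  ring

/-! ### The equations at a critical point -/

/-- At a critical point of `v` with value `y`, the right-hand side of the equation is
`E.criticalCoeff y * y * v'''`. -/
noncomputable def QEquation.criticalCoeff : QEquation → ℝ → ℝ
  | .k22, _ => 2
  | .harryDym, y => y ^ 2
  | .goodmanLax Δ, _ => -(1 / 6 * Δ ^ 2)
  | .zumbrun c₂ a, _ => -(c₂ * a ^ 2)

/-- Every term without v''' carries a factor v'. -/
theorem QEquation.rhs_eq_of_deriv_eq_zero (E : QEquation) {v : ℝ → ℝ} (hv : ContDiff ℝ 3 v)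
    {x : ℝ} (hx : deriv v x = 0) :
    E.rhs v x = E.criticalCoeff (v x) * v x * iteratedDeriv 3 v x := by
  cases E with
  | k22 => simp only [rhs, criticalCoeff, hx]; ring
  | harryDym => simp only [rhs, criticalCoeff]; ring
  | goodmanLax Δ => simp only [rhs, criticalCoeff, hx]; ring
  | zumbrun c₂ a =>
    have h1 : HasDerivAt v 0 x := hx ▸ (hv.differentiable (by norm_num) x).hasDerivAt
    have h2 : HasDerivAt (iteratedDeriv 2 v) (iteratedDeriv 3 v x) x := by
      rw [iteratedDeriv_succ (n := 2)]
      exact (hv.differentiable_iteratedDeriv 2 (by norm_cast) x).hasDerivAt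
    simp only [rhs, criticalCoeff]
    rw [(h1.fun_mul h2).deriv, (h1.fun_pow 2).deriv]
    ring

/-- Values in [0, a₀] suffice, because the barrier used for positivity never exceeds a₀. -/
theorem QEquation.exists_criticalCoeff_le (E : QEquation) (a₀ : ℝ) :
    ∃ B : ℝ, 0 ≤ B ∧ ∀ y, 0 ≤ y → y ≤ a₀ → |E.criticalCoeff y| ≤ B := by
  cases E with
  | k22 => exact ⟨2, by norm_num, fun y _ _ => by simp [criticalCoeff]⟩
  | harryDym =>
    refine ⟨a₀ ^ 2, by positivity, fun y h0 h1 => ?_⟩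
    simp only [criticalCoeff]
    rw [abs_of_nonneg (by positivity)]
    gcongr
  | goodmanLax Δ => exact ⟨_, abs_nonneg _, fun y _ _ => le_rfl⟩
  | zumbrun c₂ a => exact ⟨_, abs_nonneg _, fun y _ _ => le_rfl⟩

/-! ### Uniform continuity in time and positivity -/

/-- A solution in `C([0, T]; H⁴)` and its space derivatives of order at most three are continuous
in time, uniformly in space. -/
theorem IsH4Solution.eventually_iteratedDeriv_sub_le {M : ℝ} {hM : 0 < M} {E : QEquation}
    {u : ℝ → ℝ → ℝ} {T : ℝ} (h : IsH4Solution hM E u T) {t : ℝ} (ht : t ∈ Icc 0 T) {ε : ℝ}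
    (hε : 0 < ε) :
    ∀ᶠ s in 𝓝[Icc 0 T] t, ∀ j ≤ 3, ∀ x,
      |iteratedDeriv j (u s) x - iteratedDeriv j (u t) x| ≤ ε := by
  obtain ⟨C, hC, hemb⟩ := exists_sobolev_embedding hM
  have hlim := h.continuous t ht
  have hlim' : Tendsto (fun s => C * (sobolevENorm hM 4 (fun x => u s x - u t x)).toReal)
      (𝓝[Icc 0 T] t) (𝓝 0) := by
    simpa using ((ENNReal.tendsto_toReal ENNReal.zero_ne_top).comp hlim).const_mul C
  filter_upwards [hlim.eventually_lt_const ENNReal.zero_lt_top, hlim'.eventually_le_const hε,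
    self_mem_nhdsWithin] with s hfin hs hsT j hj x
  have hms := h.mem s hsT
  have hmt := h.mem t ht
  have hw : MemSobolev hM 4 (fun x => u s x - u t x) :=
    ⟨hms.continuous.sub hmt.continuous, fun x => by simp only [hms.periodic x, hmt.periodic x],
      hfin⟩
  have hj' : (j : WithTop ℕ∞) ≤ 3 := by exact_mod_cast hj
  rw [← iteratedDeriv_fun_sub (((hemb _ hms).1.of_le hj').contDiffAt)
    (((hemb _ hmt).1.of_le hj').contDiffAt)]
  exact ((hemb _ hw).2 j hj x).trans hs

theorem IsH4Solution.exists_iteratedDeriv_le {M : ℝ} {hM : 0 < M} {E : QEquation}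
    {u : ℝ → ℝ → ℝ} {T : ℝ} (h : IsH4Solution hM E u T) {j : ℕ} (hj : j ≤ 3) :
    ∃ K : ℝ, ∀ t ∈ Icc 0 T, ∀ x, |iteratedDeriv j (u t) x| ≤ K := by
  obtain ⟨C, hC, hemb⟩ := exists_sobolev_embedding hM
  refine isCompact_Icc.induction_on (p := fun A => ∃ K : ℝ, ∀ t ∈ A, ∀ x,
    |iteratedDeriv j (u t) x| ≤ K) ⟨0, by simp⟩ ?_ ?_ ?_
  · rintro A A' hA ⟨K, hK⟩
    exact ⟨K, fun t ht => hK t (hA ht)⟩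
  · rintro A A' ⟨K, hK⟩ ⟨K', hK'⟩
    refine ⟨max K K', fun t ht x => ?_⟩
    rcases ht with ht | ht
    · exact (hK t ht x).trans (le_max_left _ _)
    · exact (hK' t ht x).trans (le_max_right _ _)
  · intro t ht
    refine ⟨_, h.eventually_iteratedDeriv_sub_le ht one_pos,
      C * (sobolevENorm hM 4 (u t)).toReal + 1, fun s hs x => ?_⟩
    have h1 := (hemb _ (h.mem t ht)).2 j hj x
    have h2 := abs_sub_abs_le_abs_sub (iteratedDeriv j (u s) x) (iteratedDeriv j (u t) x)
    linarith [hs j hj x]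

theorem Function.Periodic.exists_forall_le_of_continuous {M : ℝ} (hM : 0 < M) {v : ℝ → ℝ}
    (hp : Function.Periodic v M) (hv : Continuous v) : ∃ x₀, ∀ x, v x₀ ≤ v x := by
  obtain ⟨x₀, -, h⟩ := isCompact_Icc.exists_isMinOn (nonempty_Icc.mpr hM.le) hv.continuousOn
  refine ⟨x₀, fun x => ?_⟩
  obtain ⟨y, hy, hxy⟩ := hp.exists_mem_Ico₀ hM x
  rw [hxy]
  exact h (Ico_subset_Icc_self hy)

/-- The equations preserve positivity as long as the solution stays in `H⁴`. -/
theorem IsH4Solution.pos {M : ℝ} {hM : 0 < M} {E : QEquation} {u : ℝ → ℝ → ℝ} {T a₀ : ℝ}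
    (h : IsH4Solution hM E u T) (ha₀ : 0 < a₀) (h0 : ∀ x, a₀ < u 0 x) :
    ∀ t ∈ Icc 0 T, ∀ x, 0 < u t x := by
  obtain ⟨C, -, hemb⟩ := exists_sobolev_embedding hM
  obtain ⟨K, hK⟩ := h.exists_iteratedDeriv_le (j := 3) le_rfl
  obtain ⟨B, hB0, hB⟩ := E.exists_criticalCoeff_le a₀
  -- The extra 1 makes the barrier a₀ exp(-Lt) decay strictly faster than the rate B * K allowed to
  -- the minimum, so that first contact is contradictory.
  set L := B * K + 1 with hL
  set φ : ℝ → ℝ := fun t => a₀ * Real.exp (-L * t) with hφ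
  have hφpos : ∀ t, 0 < φ t := fun t => by positivity
  have hφd : ∀ t, HasDerivAt φ (-L * φ t) t := fun t => by
    have := (((hasDerivAt_id t).const_mul (-L)).exp).const_mul a₀
    refine this.congr_deriv ?_
    simp only [hφ, id]
    ring
  suffices hgood : ∀ t ∈ Icc 0 T, ∀ x, φ t < u t x from
    fun t ht x => (hφpos t).trans (hgood t ht x)
  by_contra! hbad
  set A : Set ℝ := {t | t ∈ Icc 0 T ∧ ∃ x, u t x ≤ φ t} with hA
  have hAne : A.Nonempty := by
    obtain ⟨t, ht, x, hx⟩ := hbad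
    exact ⟨t, ht, x, hx⟩
  have hAsub : A ⊆ Icc 0 T := fun t ht => ht.1
  -- The contact point may move with time, hence the need for closeness uniform in x: a positive gap
  -- at the minimum of u(t) persists for all x at nearby times.
  have hAclosed : IsClosed A := by
    refine isClosed_of_closure_subset fun t htc => ?_
    have ht : t ∈ Icc 0 T := closure_minimal hAsub isClosed_Icc htc
    by_contra htA
    obtain ⟨x₀, hx₀⟩ := (h.mem t ht).periodic.exists_forall_le_of_continuous hM
      (h.mem t ht).continuous
    have hgap : 0 < u t x₀ - φ t := by
      by_contra! hle
      exact htA ⟨ht, x₀, by linarith⟩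
    have hφc : ∀ᶠ s in 𝓝 t, φ s < φ t + (u t x₀ - φ t) / 2 :=
      (hφd t).continuousAt.eventually_lt_const (by linarith)
    have huc := eventually_nhdsWithin_iff.mp
      (h.eventually_iteratedDeriv_sub_le ht (half_pos hgap))
    obtain ⟨s, hsA, hs1, hs2⟩ := ((mem_closure_iff_frequently.mp htc).and_eventually
      (hφc.and huc)).exists
    obtain ⟨x, hx⟩ := hsA.2
    have h1 := abs_le.mp (hs2 hsA.1 0 (by norm_num) x)
    simp only [iteratedDeriv_zero] at h1
    linarith [hx₀ x]
  obtain ⟨τ, ⟨hτ, x₁, hx₁⟩, hleast⟩ :=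
    (isCompact_Icc.of_isClosed_subset hAclosed hAsub).exists_isLeast hAne
  have hbefore : ∀ s, 0 ≤ s → s < τ → ∀ x, φ s < u s x := by
    intro s hs0 hs x
    by_contra! hle
    exact absurd (hleast ⟨⟨hs0, hs.le.trans hτ.2⟩, x, hle⟩) (not_le.mpr hs)
  have hτ0 : 0 < τ := by
    refine lt_of_le_of_ne hτ.1 fun h0τ => ?_
    rw [← h0τ] at hx₁
    have : φ 0 = a₀ := by simp [hφ]
    linarith [h0 x₁]
  have hmem := h.mem τ hτ
  obtain ⟨x₀, hx₀⟩ := hmem.periodic.exists_forall_le_of_continuous hM hmem.continuous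
  have hderiv : deriv (u τ) x₀ = 0 :=
    IsLocalMin.deriv_eq_zero (Eventually.of_forall hx₀)
  have hnear : ∀ᶠ s in 𝓝[<] τ, s ∈ Ico 0 τ := Ico_mem_nhdsLT hτ0
  -- Only the left derivative is available in general, since τ may equal T.
  have hd : HasDerivWithinAt (fun s => u s x₀ - φ s) (E.rhs (u τ) x₀ - -L * φ τ) (Iio τ) τ := by
    refine ((h.solves τ hτ x₀).mono_of_mem_nhdsWithin ?_).sub (hφd τ).hasDerivWithinAt
    filter_upwards [hnear] with s hs
    exact ⟨hs.1, hs.2.le.trans hτ.2⟩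
  have hle : u τ x₀ ≤ φ τ := (hx₀ x₁).trans hx₁
  have heq : u τ x₀ = φ τ := by
    refine le_antisymm hle (sub_nonneg.mp (ge_of_tendsto hd.continuousWithinAt ?_))
    filter_upwards [hnear] with s hs
    exact sub_nonneg.mpr (hbefore s hs.1 hs.2 x₀).le
  -- u - φ is positive before τ and zero at τ, so its left slopes are nonpositive. The bound on c
  -- u_xxx instead gives a derivative of at least (L - B * K) φ = φ > 0.
  have hD : E.rhs (u τ) x₀ - -L * φ τ ≤ 0 := by
    refine le_of_tendsto ((hasDerivWithinAt_iff_tendsto_slope' self_notMem_Iio).mp hd) ?_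
    filter_upwards [hnear] with s hs
    rw [slope_def_field]
    refine div_nonpos_of_nonneg_of_nonpos ?_ (by linarith [hs.2])
    linarith [hbefore s hs.1 hs.2 x₀]
  rw [E.rhs_eq_of_deriv_eq_zero (hemb _ hmem).1 hderiv, heq] at hD
  have hφle : φ τ ≤ a₀ := by
    have hK0 : 0 ≤ K := (abs_nonneg _).trans (hK τ hτ 0)
    have : Real.exp (-L * τ) ≤ 1 := Real.exp_le_one_iff.mpr (by
      rw [neg_mul, neg_nonpos]; positivity)
    simpa [hφ] using mul_le_of_le_one_right ha₀.le this
  have hprod : |E.criticalCoeff (φ τ) * iteratedDeriv 3 (u τ) x₀| ≤ B * K := by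
    rw [abs_mul]
    exact mul_le_mul (hB _ (hφpos τ).le hφle) (hK τ hτ x₀) (abs_nonneg _) hB0
  nlinarith [(abs_le.mp hprod).1, hφpos τ]

theorem mainTheorem8 {M : ℝ} (hM : 0 < M) (E : QEquation) (n : ℕ) (hn : 4 ≤ n)
    (a₀ : ℝ) (ha₀ : 0 < a₀) (u₀ : ℝ → ℝ) (hu₀ : MemSobolev hM n u₀) (hpos : ∀ x, a₀ < u₀ x)
    (xstar tstar : ℝ) (htstar : 0 < tstar) (u : ℝ → ℝ → ℝ)
    (hu : IsSingularSolution hM E u₀ u tstar) (hzero : u tstar xstar = 0) :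
    ∃ t' ∈ Ioc 0 tstar, (∀ t ∈ Ico 0 t', MemSobolev hM 4 (u t)) ∧
      Tendsto (fun t => sobolevENorm hM 4 (u t)) (𝓝[<] t') (𝓝 ∞) := by
  have hu0 : MemSobolev hM 4 (u 0) := hu.initial ▸ hu₀.mono hn
  have hpos0 : ∀ x, a₀ < u 0 x := hu.initial ▸ hpos
  have hpositive : ∀ T ∈ Icc 0 tstar, (∀ t ∈ Icc 0 T, MemSobolev hM 4 (u t)) →
      ∀ x, 0 < u T x := fun T hT hmem =>
    (hu.solution T hT hmem).pos ha₀ hpos0 T ⟨hT.1, le_rfl⟩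
  set A : Set ℝ := {T | T ∈ Icc 0 tstar ∧ ∀ t ∈ Icc 0 T, MemSobolev hM 4 (u t)} with hA
  have h0A : (0 : ℝ) ∈ A := by
    refine ⟨⟨le_rfl, htstar.le⟩, fun t ht => ?_⟩
    rwa [le_antisymm ht.2 ht.1]
  have hAbdd : BddAbove A := ⟨tstar, fun T hT => hT.1.2⟩
  set τ := sSup A with hτ
  have hτ0 : 0 ≤ τ := le_csSup hAbdd h0A
  have hτS : τ ≤ tstar := csSup_le ⟨0, h0A⟩ fun T hT => hT.1.2
  have hbefore : ∀ t ∈ Ico 0 τ, MemSobolev hM 4 (u t) := by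
    intro t ht
    obtain ⟨T, hTA, hT⟩ := exists_lt_of_lt_csSup ⟨0, h0A⟩ ht.2
    exact hTA.2 t ⟨ht.1, hT.le⟩
  have hsing : ¬ MemSobolev hM 4 (u τ) := by
    intro hmem
    have hall : ∀ t ∈ Icc 0 τ, MemSobolev hM 4 (u t) := by
      intro t ht
      rcases ht.2.eq_or_lt with h | h
      · rwa [h]
      · exact hbefore t ⟨ht.1, h⟩
    have hp := hpositive τ ⟨hτ0, hτS⟩ hall
    rcases hτS.eq_or_lt with h | h
    · rw [h] at hp
      exact (hp xstar).ne' hzero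
    · obtain ⟨T', hT', hmem'⟩ := hu.continued τ ⟨hτ0, h⟩ hall hp
      exact absurd (le_csSup hAbdd ⟨⟨hτ0.trans hT'.1.le, hT'.2⟩, hmem'⟩) (not_le.mpr hT'.1)
  have hτpos : 0 < τ := by
    refine lt_of_le_of_ne hτ0 fun h => hsing ?_
    rwa [← h]
  refine ⟨τ, ⟨hτpos, hτS⟩, hbefore, ?_⟩
  rw [ENNReal.tendsto_nhds_top_iff_nnreal]
  intro K
  by_contra hK
  have hτmem : τ ∈ Icc 0 tstar := ⟨hτ0, hτS⟩
  have hnear : ∀ᶠ s in 𝓝[<] τ, s ∈ Icc 0 tstar := by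
    filter_upwards [Ico_mem_nhdsLT hτpos] with s hs
    exact ⟨hs.1, hs.2.le.trans hτS⟩
  refine hsing (memSobolev_of_tendsto_of_frequently hM 0 4 (hu.continuous τ hτmem)
    (hu.periodic τ hτmem) (hnear.mono fun s hs => hu.continuous s hs)
    ((hu.continuous_L2 τ hτmem).mono_left (nhdsWithin_le_of_mem hnear)) (K := K) ?_)
  -- Failure of divergence means exactly that some bound K holds at times arbitrarily close to τ
  -- from the left.
  refine (not_eventually.mp hK).mono fun s hs => ?_
  rw [ENNReal.ofReal_coe_nnreal]
  exact not_lt.mp hs
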